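/- Let $f=y_0(y_0^3+y_1^3+y_2^3+y_3^3+y_4^3)+3y_1y_2y_3y_4\in\mathbb{Z}[y_0,\ldots,y_4]$. All coefficients of the Hessian determinant $\det\left(\frac{\partial^2 f}{\partial y_i\,\partial y_j}\right)_{0\le i,j\le 4}$ are divisible by $486$; put $h=\frac{1}{486}\det\left(\frac{\partial^2 f}{\partial y_i\,\partial y_j}\right)_{i,j}\in\mathbb{Z}[y_0,\ldots,y_4]$. Let $B\subset\mathbb{P}^4$ be the Burkhardt quartic threefold $f=0$ and let $\mathrm{He}(B)\subset\mathbb{P}^4$ be its Hessian hypersurface $h=0$. Let $q$ be a prime power not divisible by $3$ and let $\mathbb{F}_q$ be the finite field with $q$ elements. Then the number of $\mathbb{F}_q$-rational points of $B\setminus \mathrm{He}(B)$ (the points of $\mathbb{P}^4(\mathbb{F}_q)$ at which the reduction of $f$ vanishes and the reduction of $h$ does not) is $$\#(B\setminus \mathrm{He}(B))(\mathbb{F}_q)=\begin{cases}(q-4)(q-7)(q-13)&\text{if }q\equiv 1\pmod 3,\\ (q-2)(q^2-2q-1)&\text{if }q\equiv 2\pmod 3.\end{cases}$$ -/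

import Mathlib

open MvPolynomial
open scoped LinearAlgebra.Projectivization

namespace Burkhardt

/-- The quartic form `y₀(y₀³+y₁³+y₂³+y₃³+y₄³) + 3y₁y₂y₃y₄`, with integer coefficients. -/
noncomputable def quartic : MvPolynomial (Fin 5) ℤ :=
  X 0 * (X 0 ^ 3 + X 1 ^ 3 + X 2 ^ 3 + X 3 ^ 3 + X 4 ^ 3) + 3 * (X 1 * X 2 * X 3 * X 4)

/-- The matrix of second partial derivatives of a polynomial. -/
noncomputable def hessianMatrix (p : MvPolynomial (Fin 5) ℤ) :
    Matrix (Fin 5) (Fin 5) (MvPolynomial (Fin 5) ℤ) :=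
  Matrix.of fun i j => pderiv i (pderiv j p)

/-- The expanded quotient by `486` of the Hessian determinant of the quartic form; it only serves
to show that the quotient has integer coefficients. -/
noncomputable def hessianExpanded : MvPolynomial (Fin 5) ℤ :=
  32 * (X 0 ^ 6 * (X 1 * X 2 * X 3 * X 4))
  - 8 * (X 0 ^ 4 * (X 1 ^ 3 * X 2 ^ 3 + X 1 ^ 3 * X 3 ^ 3 + X 1 ^ 3 * X 4 ^ 3
      + X 2 ^ 3 * X 3 ^ 3 + X 2 ^ 3 * X 4 ^ 3 + X 3 ^ 3 * X 4 ^ 3))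
  + 4 * (X 0 ^ 3 * (X 1 * X 2 * X 3 * X 4) * (X 1 ^ 3 + X 2 ^ 3 + X 3 ^ 3 + X 4 ^ 3))
  + 18 * (X 0 ^ 2 * (X 1 * X 2 * X 3 * X 4) ^ 2)
  + X 0 * (X 1 ^ 6 * (X 2 ^ 3 + X 3 ^ 3 + X 4 ^ 3) + X 2 ^ 6 * (X 1 ^ 3 + X 3 ^ 3 + X 4 ^ 3)
      + X 3 ^ 6 * (X 1 ^ 3 + X 2 ^ 3 + X 4 ^ 3) + X 4 ^ 6 * (X 1 ^ 3 + X 2 ^ 3 + X 3 ^ 3)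
      - 6 * (X 1 ^ 3 * X 2 ^ 3 * X 3 ^ 3 + X 1 ^ 3 * X 2 ^ 3 * X 4 ^ 3
        + X 1 ^ 3 * X 3 ^ 3 * X 4 ^ 3 + X 2 ^ 3 * X 3 ^ 3 * X 4 ^ 3))
  + X 1 * X 2 * X 3 * X 4 * (X 1 ^ 3 * X 2 ^ 3 + X 1 ^ 3 * X 3 ^ 3 + X 1 ^ 3 * X 4 ^ 3
      + X 2 ^ 3 * X 3 ^ 3 + X 2 ^ 3 * X 4 ^ 3 + X 3 ^ 3 * X 4 ^ 3
      - X 1 ^ 6 - X 2 ^ 6 - X 3 ^ 6 - X 4 ^ 6)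

theorem det_hessianMatrix_quartic :
    (hessianMatrix quartic).det = 486 * hessianExpanded := by
  have h3 (i : Fin 5) : pderiv i (3 : MvPolynomial (Fin 5) ℤ) = 0 :=
    Derivation.map_natCast (pderiv i) 3
  have hM : hessianMatrix quartic =
      !![12 * X 0 ^ 2, 3 * X 1 ^ 2, 3 * X 2 ^ 2, 3 * X 3 ^ 2, 3 * X 4 ^ 2;
         3 * X 1 ^ 2, 6 * X 0 * X 1, 3 * X 3 * X 4, 3 * X 2 * X 4, 3 * X 2 * X 3;
         3 * X 2 ^ 2, 3 * X 3 * X 4, 6 * X 0 * X 2, 3 * X 1 * X 4, 3 * X 1 * X 3;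
         3 * X 3 ^ 2, 3 * X 2 * X 4, 3 * X 1 * X 4, 6 * X 0 * X 3, 3 * X 1 * X 2;
         3 * X 4 ^ 2, 3 * X 2 * X 3, 3 * X 1 * X 3, 3 * X 1 * X 2, 6 * X 0 * X 4] := by
    ext1 i j
    fin_cases i <;> fin_cases j <;>
      (simp [hessianMatrix, quartic, Derivation.leibniz, Derivation.leibniz_pow, pderiv_X,
        Pi.single_apply, h3]; try ring_nf)
  rw [hM, hessianExpanded]
  simp [Matrix.det_succ_row_zero, Fin.sum_univ_succ, Fin.succAbove]
  ring

theorem dvd_det_hessianMatrix_quartic :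
    (486 : MvPolynomial (Fin 5) ℤ) ∣ (hessianMatrix quartic).det :=
  ⟨_, det_hessianMatrix_quartic⟩

/-- The form `(1/486) det (∂²f/∂yᵢ∂yⱼ)` with `f` the quartic form: the unique polynomial with
integer coefficients whose product with `486` is the Hessian determinant of `f`. -/
noncomputable def hessian : MvPolynomial (Fin 5) ℤ :=
  dvd_det_hessianMatrix_quartic.choose

theorem hessian_spec : (hessianMatrix quartic).det = 486 * hessian :=
  dvd_det_hessianMatrix_quartic.choose_spec

theorem hessian_eq : hessian = hessianExpanded := by
  have h := hessian_spec.symm.trans det_hessianMatrix_quartic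
  exact mul_left_cancel₀ (by norm_num) h

/-- The points of projective space over `K` at which a form with integer coefficients vanishes. -/
def zeroLocus {n : ℕ} (p : MvPolynomial (Fin n) ℤ) (K : Type*) [Field K] :
    Set (ℙ K (Fin n → K)) :=
  {P | aeval P.rep p = 0}

/-- For a form, vanishing may be tested on any representative of the point. -/
theorem mk_mem_zeroLocus {n d : ℕ} {p : MvPolynomial (Fin n) ℤ} {K : Type*} [Field K]
    (hp : ∀ (a : K) (v : Fin n → K), aeval (a • v) p = a ^ d * aeval v p)
    (v : Fin n → K) (hv : v ≠ 0) :
    Projectivization.mk K v hv ∈ zeroLocus p K ↔ aeval v p = 0 := by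
  obtain ⟨a, ha⟩ := Projectivization.exists_smul_eq_mk_rep K v hv
  have h : aeval (Projectivization.mk K v hv).rep p = (a : K) ^ d * aeval v p := by
    rw [← ha, ← hp]; rfl
  simp [zeroLocus, h]

theorem aeval_smul_quartic {K : Type*} [Field K] (a : K) (v : Fin 5 → K) :
    aeval (a • v) quartic = a ^ 4 * aeval v quartic := by
  simp [quartic]
  ring

theorem aeval_smul_hessian {K : Type*} [Field K] (a : K) (v : Fin 5 → K) :
    aeval (a • v) hessian = a ^ 10 * aeval v hessian := by
  rw [hessian_eq]
  simp [hessianExpanded]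
  ring

/-- The `K`-points of the quartic threefold in `ℙ⁴`. -/
def B (K : Type*) [Field K] : Set (ℙ K (Fin 5 → K)) := zeroLocus quartic K

/-- The `K`-points of the Hessian hypersurface of the quartic threefold. -/
def He (K : Type*) [Field K] : Set (ℙ K (Fin 5 → K)) := zeroLocus hessian K

theorem mk_mem_B {K : Type*} [Field K] (v : Fin 5 → K) (hv : v ≠ 0) :
    Projectivization.mk K v hv ∈ B K ↔ aeval v quartic = 0 :=
  mk_mem_zeroLocus aeval_smul_quartic v hv

theorem mk_mem_He {K : Type*} [Field K] (v : Fin 5 → K) (hv : v ≠ 0) :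
    Projectivization.mk K v hv ∈ He K ↔ aeval v hessian = 0 :=
  mk_mem_zeroLocus aeval_smul_hessian v hv

end Burkhardt

/-!
A point of the quartic with `y₀ = 0` has `y₁y₂y₃y₄ = 0` and lies on the Hessian. In the chart
`y₀ = 1`, with coordinates `a, b, c, d`, the Hessian is congruent to
`-9 (1 + a³)(1 + b³)(1 + c³)(1 + d³)` modulo the equation `1 + a³ + b³ + c³ + d³ + 3abcd = 0`. So
the points to be counted are the solutions of this equation none of whose coordinates is a cube
root of `-1`; call an element of `F` admissible if it is not a cube root of `-1`.

Let `N` be the norm form of `F[g]/(g³ - 1)`, that is `N(r + sg + wg²) = r³ + s³ + w³ - 3rsw`. The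
equation reads `N(c + dg - abg²) + N(1 + ag) N(1 + bg) = 0`. For admissible `a` and `b` the
solutions `(c, d)` hence correspond to the elements `t = r + sg + wg²` of norm one with
`-t (1 + ag)(1 + bg)` of the form `c + dg - abg²`, that is, with
`((r - 1)a + s)b + (sa + w) = 0` (`count_affineQuartic_eq_count_normForm`). This is linear in `b`,
so the triples `(t, a, b)` are counted by solving for `b` (`count_linear`). The correction terms,
namely the norm-one elements on which some coefficients vanish and the solutions with `b³ = -1`,
live on rational curves, because `N` is the product of `r + s + w` and a quadratic form in the
differences `r - s` and `s - w`; see `count_normForm_eq_one_and_bilinear`.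

It remains to discard the solutions with `c` or `d` a cube root of `-1`, by inclusion-exclusion
(`count_affineQuartic`). For `c = -1` the equation becomes `N(a + bg + dg²) = 0`, which again
factors.

Everything is expressed through `q` and the number `e` of roots of `v² + v + 1`, which is `2` or `0`
according as `q` is `1` or `2` modulo `3`; there are `e + 1` cube roots of `-1`.
-/

namespace Burkhardt

/-! ### Counting solutions -/

open Classical in
/-- The number of elements of a finite type that satisfy `P`, as an integer. -/
noncomputable def count {α : Type*} [Fintype α] (P : α → Prop) : ℤ :=
  ∑ x, if P x then 1 else 0

section Count

variable {α β : Type*} [Fintype α] [Fintype β]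

theorem count_eq_natCard (P : α → Prop) : count P = Nat.card {x // P x} := by
  classical
  simp [count, Fintype.card_subtype]

theorem count_congr {P Q : α → Prop} (h : ∀ x, P x ↔ Q x) : count P = count Q := by
  rw [funext fun x => propext (h x)]

theorem count_bij {P : α → Prop} {Q : β → Prop} (f : α → β) (g : β → α)
    (hf : ∀ x, P x → Q (f x)) (hg : ∀ y, Q y → P (g y))
    (hgf : ∀ x, P x → g (f x) = x) (hfg : ∀ y, Q y → f (g y) = y) : count P = count Q := by
  rw [count_eq_natCard, count_eq_natCard]
  exact congrArg _ (Nat.card_congr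
    { toFun := fun x => ⟨f x, hf x x.2⟩
      invFun := fun y => ⟨g y, hg y y.2⟩
      left_inv := fun x => Subtype.ext (hgf x x.2)
      right_inv := fun y => Subtype.ext (hfg y y.2) })

theorem count_true : count (fun _ : α => True) = Nat.card α := by
  simp [count]

theorem count_eq_zero {P : α → Prop} (h : ∀ x, ¬ P x) : count P = 0 := by
  simp [count, h]

theorem count_eq_one {P : α → Prop} (a : α) (h : ∀ x, P x ↔ x = a) : count P = 1 := by
  rw [count_congr h, count_eq_natCard]
  simp

theorem count_and_add (P Q : α → Prop) :
    count (fun x => P x ∧ Q x) + count (fun x => P x ∧ ¬ Q x) = count P := by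
  classical
  simp only [count, ← Finset.sum_add_distrib]
  refine Finset.sum_congr rfl fun x _ => ?_
  by_cases hP : P x <;> by_cases hQ : Q x <;> simp [hP, hQ]

theorem count_and_not (P Q : α → Prop) :
    count (fun x => P x ∧ ¬ Q x) = count P - count (fun x => P x ∧ Q x) := by
  linarith [count_and_add P Q]

theorem count_not (P : α → Prop) : count (fun x => ¬ P x) = Nat.card α - count P := by
  have h := count_and_not (fun _ => True) P
  simpa [count_true] using h

theorem count_or (P Q : α → Prop) :
    count (fun x => P x ∨ Q x) = count P + count Q - count (fun x => P x ∧ Q x) := by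
  classical
  simp only [count, ← Finset.sum_add_distrib, ← Finset.sum_sub_distrib]
  refine Finset.sum_congr rfl fun x _ => ?_
  by_cases hP : P x <;> by_cases hQ : Q x <;> simp [hP, hQ]

theorem count_prod (P : α × β → Prop) : count P = ∑ a, count fun b => P (a, b) := by
  simp only [count, Fintype.sum_prod_type]

/-- A family of finite sets of constant size `c`, over the elements satisfying `Q`. -/
theorem count_prod_const (Q : α → Prop) (P : α → β → Prop) (c : ℤ)
    (h : ∀ a, Q a → count (P a) = c) :
    count (fun x : α × β => Q x.1 ∧ P x.1 x.2) = count Q * c := by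
  classical
  rw [count_prod, count, Finset.sum_mul]
  refine Finset.sum_congr rfl fun a _ => ?_
  by_cases hQ : Q a
  · simp [hQ, h a hQ]
  · simp [hQ, count]

theorem count_swap (P : α × β → Prop) : count P = count fun x : β × α => P (x.2, x.1) :=
  count_bij Prod.swap Prod.swap (by simp) (by simp) (by simp) (by simp)

end Count

section LinearEquation

variable {F : Type*} [Field F] [Fintype F] {α : Type*} [Fintype α]

/-- The solutions of a linear equation in one unknown whose coefficients depend on a parameter:
there is one for each parameter, except that there are none or `q` where the leading coefficient
vanishes. -/
theorem count_linear (P : α → Prop) (A B : α → F) :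
    count (fun x : α × F => P x.1 ∧ A x.1 * x.2 + B x.1 = 0) =
      count P - count (fun x => P x ∧ A x = 0) +
        Nat.card F * count (fun x => P x ∧ A x = 0 ∧ B x = 0) := by
  classical
  rw [count_prod]
  simp only [count, Finset.mul_sum, ← Finset.sum_add_distrib, ← Finset.sum_sub_distrib]
  refine Finset.sum_congr rfl fun x _ => ?_
  change (count fun b : F => P x ∧ A x * b + B x = 0) = _
  by_cases hP : P x
  · by_cases hA : A x = 0
    · by_cases hB : B x = 0
      · simp [hP, hA, hB, count_true]
      · simp [hP, hA, hB, count_eq_zero]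
    · have h1 : count (fun b : F => P x ∧ A x * b + B x = 0) = 1 := by
        refine count_eq_one (-B x / A x) fun b => ?_
        rw [eq_div_iff hA]
        constructor
        · rintro ⟨-, h⟩
          linear_combination h
        · intro h
          exact ⟨hP, by linear_combination h⟩
      rw [h1]
      simp [hP, hA]
  · simp [hP, count_eq_zero]

end LinearEquation

/-! ### The norm-one torus -/

section Torus

variable {F : Type*} [Field F]

/-- The norm form of the group algebra `F[g]/(g³ - 1)`, in the basis `1, g, g²`. -/
def normForm (t : F × F × F) : F :=
  t.1 ^ 3 + t.2.1 ^ 3 + t.2.2 ^ 3 - 3 * t.1 * t.2.1 * t.2.2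

theorem normForm_eq_mul (t : F × F × F) :
    normForm t = (t.1 + t.2.1 + t.2.2) *
      ((t.1 - t.2.1) ^ 2 + (t.1 - t.2.1) * (t.2.1 - t.2.2) + (t.2.1 - t.2.2) ^ 2) := by
  rw [normForm]
  ring

theorem ne_neg_one_of_cube {x : F} (h : x ^ 3 ≠ -1) : x ≠ -1 := by
  rintro rfl
  norm_num at h

theorem two_cube_ne_neg_one (h3 : (3 : F) ≠ 0) : (2 : F) ^ 3 ≠ -1 := by
  intro h
  apply h3
  have : (3 : F) ^ 2 = 0 := by linear_combination h
  simpa using this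

variable [Fintype F]

theorem count_cube_eq_neg_one (h3 : (3 : F) ≠ 0) :
    count (fun x : F => x ^ 3 = -1) = count (fun v : F => v ^ 2 + v + 1 = 0) + 1 := by
  have h1 : count (fun x : F => x ^ 3 = -1) =
      count (fun x : F => x = -1 ∨ x ^ 2 - x + 1 = 0) := by
    refine count_congr fun x => ?_
    rw [← add_eq_zero_iff_eq_neg, ← add_eq_zero_iff_eq_neg, ← mul_eq_zero]
    refine iff_of_eq (congrArg (· = 0) ?_)
    ring
  have h2 : count (fun x : F => x ^ 2 - x + 1 = 0) = count (fun v : F => v ^ 2 + v + 1 = 0) := by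
    refine count_bij (fun x => -x) (fun x => -x) ?_ ?_ (by simp) (by simp)
    · intro x h
      linear_combination h
    · intro x h
      linear_combination h
  have h4 : count (fun x : F => x = -1 ∧ x ^ 2 - x + 1 = 0) = 0 := by
    refine count_eq_zero ?_
    rintro x ⟨rfl, h⟩
    apply h3
    linear_combination h
  rw [h1, count_or, h2, h4, count_eq_one (-1) (fun x => Iff.rfl)]
  ring

theorem count_quadratic_of_ne_zero {u : F} (hu : u ≠ 0) :
    count (fun v : F => u ^ 2 + u * v + v ^ 2 = 0) = count (fun v : F => v ^ 2 + v + 1 = 0) := by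
  refine count_bij (fun v => v / u) (fun v => u * v) ?_ ?_ ?_ ?_
  · intro v h
    field_simp
    linear_combination h
  · intro v h
    linear_combination u ^ 2 * h
  · intro v _
    field_simp
  · intro v _
    field_simp

theorem count_quadratic :
    count (fun x : F × F => x.1 ^ 2 + x.1 * x.2 + x.2 ^ 2 = 0) =
      1 + ((Nat.card F : ℤ) - 1) * count (fun v : F => v ^ 2 + v + 1 = 0) := by
  have h := count_and_add (fun x : F × F => x.1 ^ 2 + x.1 * x.2 + x.2 ^ 2 = 0) (fun x => x.1 = 0)
  have h0 : count (fun x : F × F => x.1 ^ 2 + x.1 * x.2 + x.2 ^ 2 = 0 ∧ x.1 = 0) = 1 := by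
    refine count_eq_one (0, 0) ?_
    rintro ⟨u, v⟩
    constructor
    · rintro ⟨h, rfl⟩
      simpa using h
    · intro h
      simp_all
  have h1 := count_prod_const (fun u : F => ¬ u = 0)
    (fun u v : F => u ^ 2 + u * v + v ^ 2 = 0) _ (fun u hu => count_quadratic_of_ne_zero hu)
  rw [count_not, count_eq_one (0 : F) (fun _ => Iff.rfl)] at h1
  rw [← h, h0, ← h1]
  congr 1
  exact count_congr fun x => and_comm

/-- A norm-one element is determined by the differences of its consecutive coordinates, as these
determine the second factor of the norm form and hence the coordinate sum. -/
theorem count_normForm_eq_one_and (h3 : (3 : F) ≠ 0) (P : F → F → Prop) :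
    count (fun t : F × F × F => normForm t = 1 ∧ P (t.1 - t.2.1) (t.2.1 - t.2.2)) =
      count (fun x : F × F => P x.1 x.2 ∧ ¬ x.1 ^ 2 + x.1 * x.2 + x.2 ^ 2 = 0) := by
  refine count_bij (fun t => (t.1 - t.2.1, t.2.1 - t.2.2))
    (fun x => (((x.1 ^ 2 + x.1 * x.2 + x.2 ^ 2)⁻¹ + 2 * x.1 + x.2) / 3,
      ((x.1 ^ 2 + x.1 * x.2 + x.2 ^ 2)⁻¹ - x.1 + x.2) / 3,
      ((x.1 ^ 2 + x.1 * x.2 + x.2 ^ 2)⁻¹ - x.1 - 2 * x.2) / 3)) ?_ ?_ ?_ ?_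
  · rintro t ⟨h, hP⟩
    rw [normForm_eq_mul] at h
    exact ⟨hP, right_ne_zero_of_mul (h ▸ one_ne_zero)⟩
  · rintro ⟨u, v⟩ ⟨hP, h⟩
    dsimp only at hP h ⊢
    set σ := (u ^ 2 + u * v + v ^ 2)⁻¹ with hσ
    have hu : (σ + 2 * u + v) / 3 - (σ - u + v) / 3 = u := by field_simp; ring
    have hv : (σ - u + v) / 3 - (σ - u - 2 * v) / 3 = v := by field_simp; ring
    have hs : (σ + 2 * u + v) / 3 + (σ - u + v) / 3 + (σ - u - 2 * v) / 3 = σ := by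
      field_simp; ring
    rw [normForm_eq_mul]
    simp only [hu, hv, hs]
    exact ⟨inv_mul_cancel₀ h, hP⟩
  · rintro ⟨r, s, w⟩ ⟨h, -⟩
    rw [normForm_eq_mul] at h
    dsimp only at h ⊢
    rw [← eq_inv_of_mul_eq_one_left h]
    refine Prod.ext ?_ (Prod.ext ?_ ?_) <;> dsimp only <;> field_simp <;> ring
  · rintro ⟨u, v⟩ -
    refine Prod.ext ?_ ?_ <;> dsimp only <;> field_simp <;> ring

theorem count_normForm_eq_one (h3 : (3 : F) ≠ 0) :
    count (fun t : F × F × F => normForm t = 1) =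
      (Nat.card F : ℤ) ^ 2 - 1 -
        ((Nat.card F : ℤ) - 1) * count (fun v : F => v ^ 2 + v + 1 = 0) := by
  have h := count_normForm_eq_one_and h3 (fun _ _ => True)
  simp only [and_true, true_and, count_not, count_quadratic, Nat.card_prod] at h
  rw [h]
  push_cast
  ring

/-- Multiplying the group element `g` by a cube root of unity is an automorphism of the group
algebra, so it preserves the norm. -/
theorem count_normForm_eq_one_scale {z : F} (hz : z ^ 3 = 1) (P : F → F → F → Prop) :
    count (fun t : F × F × F => normForm t = 1 ∧ P t.1 t.2.1 t.2.2) =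
      count (fun t : F × F × F => normForm t = 1 ∧ P t.1 (z * t.2.1) (z ^ 2 * t.2.2)) := by
  refine count_bij (fun t => (t.1, z ^ 2 * t.2.1, z * t.2.2))
    (fun t => (t.1, z * t.2.1, z ^ 2 * t.2.2)) ?_ ?_ ?_ ?_
  · rintro ⟨r, s, w⟩ ⟨h, hP⟩
    simp only [normForm] at h hP ⊢
    have e1 : z * (z ^ 2 * s) = s := by linear_combination s * hz
    have e2 : z ^ 2 * (z * w) = w := by linear_combination w * hz
    rw [e1, e2]
    refine ⟨?_, hP⟩
    linear_combination h + (s ^ 3 * (z ^ 3 + 1) + w ^ 3 - 3 * r * s * w) * hz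
  · rintro ⟨r, s, w⟩ ⟨h, hP⟩
    simp only [normForm] at h hP ⊢
    refine ⟨?_, hP⟩
    linear_combination h + (w ^ 3 * (z ^ 3 + 1) + s ^ 3 - 3 * r * s * w) * hz
  · rintro ⟨r, s, w⟩ -
    refine Prod.ext rfl (Prod.ext ?_ ?_) <;> dsimp only
    · linear_combination s * hz
    · linear_combination w * hz
  · rintro ⟨r, s, w⟩ -
    refine Prod.ext rfl (Prod.ext ?_ ?_) <;> dsimp only
    · linear_combination s * hz
    · linear_combination w * hz

/-- The plane `r = 1` cuts the norm-one surface in a nodal cubic, parametrized by the slope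
`m = w / s`. -/
theorem count_normForm_eq_one_and_fst_eq_one (h3 : (3 : F) ≠ 0) :
    count (fun t : F × F × F => normForm t = 1 ∧ t.1 - 1 = 0) =
      Nat.card F - count (fun x : F => x ^ 3 = -1) := by
  rw [← count_not]
  refine count_bij (fun t => t.2.2 / t.2.1)
    (fun m => (1, 3 * m / (1 + m ^ 3), 3 * m ^ 2 / (1 + m ^ 3))) ?_ ?_ ?_ ?_
  · rintro ⟨r, s, w⟩ ⟨h, hr⟩
    simp only [normForm] at h hr ⊢
    obtain rfl : r = 1 := sub_eq_zero.mp hr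
    by_cases hs : s = 0
    · simp [hs]
    intro hm
    rw [div_pow, div_eq_iff (pow_ne_zero 3 hs)] at hm
    have hw : 3 * s * w = 0 := by linear_combination hm - h
    have hw0 : w = 0 := by simpa [h3, hs] using hw
    subst hw0
    apply hs
    have : s ^ 3 = 0 := by linear_combination h
    simpa using this
  · intro m hm
    have hm' : 1 + m ^ 3 ≠ 0 := fun h => hm (by linear_combination h)
    refine ⟨?_, sub_self 1⟩
    simp only [normForm]
    field_simp
    ring
  · rintro ⟨r, s, w⟩ ⟨h, hr⟩
    simp only [normForm] at h hr ⊢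
    obtain rfl : r = 1 := sub_eq_zero.mp hr
    by_cases hs : s = 0
    · subst hs
      have : w ^ 3 = 0 := by linear_combination h
      have : w = 0 := by simpa using this
      simp [this]
    have hD : s ^ 3 + w ^ 3 ≠ 0 := by
      intro hD
      have hw : 3 * s * w = 0 := by linear_combination hD - h
      have hw0 : w = 0 := by simpa [h3, hs] using hw
      simp [hw0, hs] at hD
    have hm' : 1 + (w / s) ^ 3 ≠ 0 := by
      intro h'
      apply hD
      have : s ^ 3 * (1 + (w / s) ^ 3) = s ^ 3 + w ^ 3 := by field_simp
      rw [← this, h', mul_zero]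
    refine Prod.ext rfl (Prod.ext ?_ ?_) <;> dsimp only <;> rw [div_eq_iff hm'] <;> field_simp
    · linear_combination -h
    · linear_combination -w * h
  · intro m hm
    have hm' : 1 + m ^ 3 ≠ 0 := fun h => hm (by linear_combination h)
    by_cases hm0 : m = 0
    · simp [hm0]
    · dsimp only
      field_simp

theorem count_normForm_eq_one_and_fst_snd :
    count (fun t : F × F × F => normForm t = 1 ∧ t.1 - 1 = 0 ∧ t.2.1 = 0) = 1 := by
  refine count_eq_one (1, 0, 0) ?_
  rintro ⟨r, s, w⟩
  simp only [normForm, Prod.mk.injEq]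
  constructor
  · rintro ⟨h, hr, rfl⟩
    obtain rfl : r = 1 := sub_eq_zero.mp hr
    have : w ^ 3 = 0 := by linear_combination h
    exact ⟨rfl, rfl, by simpa using this⟩
  · rintro ⟨rfl, rfl, rfl⟩
    simp

/-- A plane `s = -a (r - 1)` with `a³ = -1` leaves only the second factor of the norm form to be
nonzero; a rescaling reduces to `a = -1`, where the plane is `r - s = 1`. -/
theorem count_normForm_eq_one_and_root (h3 : (3 : F) ≠ 0) {a : F} (ha : a ^ 3 = -1) :
    count (fun t : F × F × F => normForm t = 1 ∧ (t.1 - 1) * a + t.2.1 = 0) =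
      Nat.card F - count (fun v : F => v ^ 2 + v + 1 = 0) := by
  have ha0 : a ≠ 0 := by
    rintro rfl
    simp at ha
  rw [count_normForm_eq_one_scale (z := -a) (by linear_combination -ha)
    (fun r s _ => (r - 1) * a + s = 0)]
  have h := count_normForm_eq_one_and h3 (fun u _ : F => u = 1)
  have e1 : count (fun t : F × F × F => normForm t = 1 ∧ (t.1 - 1) * a + -a * t.2.1 = 0) =
      count (fun t : F × F × F => normForm t = 1 ∧ t.1 - t.2.1 = 1) := by
    refine count_congr fun t => and_congr_right fun _ => ?_
    have : (t.1 - 1) * a + -a * t.2.1 = a * (t.1 - t.2.1 - 1) := by ring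
    rw [this, mul_eq_zero, or_iff_right ha0, sub_eq_zero]
  rw [e1, h, ← count_not]
  refine count_bij (fun x => x.2) (fun v => (1, v)) ?_ ?_ ?_ ?_
  · rintro ⟨u, v⟩ ⟨hu, h⟩ hv
    dsimp only at hu h hv
    subst hu
    exact h (by linear_combination hv)
  · intro v hv
    exact ⟨rfl, fun h => hv (by linear_combination h)⟩
  · rintro ⟨u, v⟩ ⟨rfl, -⟩
    rfl
  · intro v _
    rfl

/-- Both coefficients of the equation that is linear in `b` vanish on a line through the identity.
In the parameter `v = (1 + a³)(r - 1) + 1` of this line, `N - 1` is proportional to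
`(v - 1)(v² + v + 1)`. -/
theorem count_normForm_eq_one_and_both (h3 : (3 : F) ≠ 0) {a : F} (ha : ¬ a ^ 3 = -1) :
    count (fun t : F × F × F => normForm t = 1 ∧ (t.1 - 1) * a + t.2.1 = 0 ∧
      t.2.1 * a + t.2.2 = 0) = 1 + count (fun v : F => v ^ 2 + v + 1 = 0) := by
  have hk : 1 + a ^ 3 ≠ 0 := fun h => ha (by linear_combination h)
  have h1 : count (fun t : F × F × F => normForm t = 1 ∧ (t.1 - 1) * a + t.2.1 = 0 ∧
      t.2.1 * a + t.2.2 = 0) = count (fun v : F => v = 1 ∨ v ^ 2 + v + 1 = 0) := by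
    refine count_bij (fun t => (t.1 - 1) * (1 + a ^ 3) + 1)
      (fun y => (1 + (y - 1) / (1 + a ^ 3), -a * ((y - 1) / (1 + a ^ 3)),
        a ^ 2 * ((y - 1) / (1 + a ^ 3)))) ?_ ?_ ?_ ?_
    · rintro ⟨r, s, w⟩ ⟨h, hs, hw⟩
      simp only [normForm] at h hs hw ⊢
      obtain rfl : s = -a * (r - 1) := by linear_combination hs
      obtain rfl : w = a ^ 2 * (r - 1) := by linear_combination hw
      rw [← sub_eq_zero, ← mul_eq_zero]
      linear_combination (1 + a ^ 3) * h
    · intro y hy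
      rw [← sub_eq_zero, ← mul_eq_zero] at hy
      refine ⟨?_, by dsimp only; ring, by dsimp only; ring⟩
      simp only [normForm]
      field_simp
      linear_combination (1 + a ^ 3) ^ 2 * hy
    · rintro ⟨r, s, w⟩ ⟨-, hs, hw⟩
      dsimp only at hs hw ⊢
      refine Prod.ext ?_ (Prod.ext ?_ ?_) <;> dsimp only <;> field_simp
      · ring
      · linear_combination -(1 + a ^ 3) * hs
      · linear_combination (1 + a ^ 3) * (a * hs - hw)
    · intro y _
      dsimp only
      field_simp
      ring
  have h4 : count (fun v : F => v = 1 ∧ v ^ 2 + v + 1 = 0) = 0 := by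
    refine count_eq_zero ?_
    rintro v ⟨rfl, h⟩
    apply h3
    linear_combination h
  rw [h1, count_or, h4, count_eq_one (1 : F) (fun _ => Iff.rfl)]
  ring

open Classical in
/-- For `b³ = -1` a rescaling reduces to `b = -1`. The bilinear equation then is an equation of a
line in the differences `u = r - s` and `v = s - w`, from which the zeros of `u² + uv + v²` have to
be discarded. -/
theorem count_normForm_eq_one_and_bilinear_root (h3 : (3 : F) ≠ 0) {a b : F}
    (ha : ¬ a ^ 3 = -1) (hb : b ^ 3 = -1) :
    count (fun t : F × F × F => normForm t = 1 ∧
      ((t.1 - 1) * a + t.2.1) * b + (t.2.1 * a + t.2.2) = 0) =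
      Nat.card F - if a = 0 then 1 else count (fun v : F => v ^ 2 + v + 1 = 0) := by
  have hb0 : b ≠ 0 := by
    rintro rfl
    simp at hb
  rw [count_normForm_eq_one_scale (z := -b) (by linear_combination -hb)
    (fun r s w => ((r - 1) * a + s) * b + (s * a + w) = 0)]
  obtain ⟨c, rfl⟩ : ∃ c, a = -b * c := ⟨-a / b, by field_simp⟩
  have hc : 1 + c ≠ 0 := by
    intro h
    obtain rfl : c = -1 := by linear_combination h
    exact ha (by linear_combination hb)
  have hc' : 1 - c + c ^ 2 ≠ 0 := by
    intro h
    apply ha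
    linear_combination hb * (-c ^ 3) + (1 + c) * h
  have e1 : count (fun t : F × F × F => normForm t = 1 ∧
        ((t.1 - 1) * (-b * c) + -b * t.2.1) * b +
          (-b * t.2.1 * (-b * c) + (-b) ^ 2 * t.2.2) = 0) =
      count (fun t : F × F × F => normForm t = 1 ∧ t.2.1 - t.2.2 = c * (1 - (t.1 - t.2.1))) := by
    refine count_congr fun t => and_congr_right fun _ => ?_
    have : ((t.1 - 1) * (-b * c) + -b * t.2.1) * b +
          (-b * t.2.1 * (-b * c) + (-b) ^ 2 * t.2.2) =
        -b ^ 2 * ((t.2.1 - t.2.2) - c * (1 - (t.1 - t.2.1))) := by ring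
    rw [this, mul_eq_zero, or_iff_right (neg_ne_zero.mpr (pow_ne_zero 2 hb0)), sub_eq_zero]
  rw [e1, count_normForm_eq_one_and h3 (fun u v => v = c * (1 - u)), count_and_not]
  have e2 : count (fun x : F × F => x.2 = c * (1 - x.1)) = Nat.card F := by
    rw [← count_true]
    refine count_bij (fun x => x.1) (fun u => (u, c * (1 - u))) (by simp) (by simp) ?_ (by simp)
    rintro ⟨u, v⟩ h
    exact Prod.ext rfl h.symm
  rw [e2]
  congr 1
  split_ifs with h0
  · have hc0 : c = 0 := by simpa [hb0] using h0
    subst hc0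
    refine count_eq_one (0, 0) ?_
    rintro ⟨u, v⟩
    simp only [Prod.mk.injEq, zero_mul]
    constructor
    · rintro ⟨rfl, h⟩
      exact ⟨by simpa using h, rfl⟩
    · rintro ⟨rfl, rfl⟩
      simp
  · have hc0 : c ≠ 0 := by
      rintro rfl
      simp at h0
    -- The points of the line on the two conjugate lines `u = y v` with `y² + y + 1 = 0`.
    have hy : ∀ y : F, y ^ 2 + y + 1 = 0 → 1 + c * y ≠ 0 := by
      intro y hy h
      apply hc'
      apply (mul_eq_zero.mp (?_ : (1 + c) * (1 - c + c ^ 2) = 0)).resolve_left hc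
      linear_combination (1 - c * y + c ^ 2 * y ^ 2) * h - c ^ 3 * (y - 1) * hy
    refine count_bij (fun x => x.1 / x.2) (fun y => (y * (c / (1 + c * y)), c / (1 + c * y)))
      ?_ ?_ ?_ ?_
    · rintro ⟨u, v⟩ ⟨hv, h⟩
      dsimp only at hv h ⊢
      have hv0 : v ≠ 0 := by
        intro hv0
        rw [hv0] at h hv
        have hu : u = 0 := by simpa using h
        rw [hu] at hv
        exact hc0 (by linear_combination -hv)
      field_simp
      linear_combination h
    · intro y h
      have := hy y h
      dsimp only
      refine ⟨by field_simp; ring, ?_⟩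
      linear_combination (c / (1 + c * y)) ^ 2 * h
    · rintro ⟨u, v⟩ ⟨hv, h⟩
      dsimp only at hv h ⊢
      have hv0 : v ≠ 0 := by
        intro hv0
        rw [hv0] at h hv
        have hu : u = 0 := by simpa using h
        rw [hu] at hv
        exact hc0 (by linear_combination -hv)
      have hvu : v + c * u = c := by linear_combination hv
      have e : c / (1 + c * (u / v)) = v := by
        have : 1 + c * (u / v) = c / v := by
          field_simp
          exact hvu
        rw [this]
        field_simp
      rw [e]
      exact Prod.ext (by field_simp) rfl
    · intro y h
      dsimp only
      rw [mul_div_assoc, div_self (div_ne_zero hc0 (hy y h)), mul_one]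

end Torus

/-! ### Points of the affine chart -/

section Chart

variable {F : Type*} [Field F]

/-- The dehomogenization at `y₀ = 1` of the quartic form. -/
def affineQuartic (a b c d : F) : F := 1 + a ^ 3 + b ^ 3 + c ^ 3 + d ^ 3 + 3 * a * b * c * d

theorem normForm_eq_zero_iff {a b d : F} :
    normForm (a, b, d) = 0 ↔ d = -a - b ∨ (a - b) ^ 2 + (a - b) * (b - d) + (b - d) ^ 2 = 0 := by
  rw [normForm_eq_mul, mul_eq_zero]
  refine or_congr_left ⟨fun h => ?_, fun h => ?_⟩
  · linear_combination h
  · linear_combination h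

theorem neg_sub_quadratic_iff (h3 : (3 : F) ≠ 0) {a b d : F} (hd : d = -a - b) :
    (a - b) ^ 2 + (a - b) * (b - d) + (b - d) ^ 2 = 0 ↔ a ^ 2 + a * b + b ^ 2 = 0 := by
  have h : (a - b) ^ 2 + (a - b) * (b - d) + (b - d) ^ 2 = 3 * (a ^ 2 + a * b + b ^ 2) := by
    rw [hd]
    ring
  rw [h, mul_eq_zero, or_iff_right h3]

variable [Fintype F]

/-- The variant of `count_prod_const` in which the size of the sets depends on whether `D` holds. -/
theorem count_prod_const_split {α β : Type*} [Fintype α] [Fintype β] (Q D : α → Prop)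
    (P : α → β → Prop) (c d : ℤ) (hc : ∀ a, Q a → D a → count (P a) = c)
    (hd : ∀ a, Q a → ¬ D a → count (P a) = d) :
    count (fun x : α × β => Q x.1 ∧ P x.1 x.2) =
      count (fun a => Q a ∧ D a) * c + (count Q - count (fun a => Q a ∧ D a)) * d := by
  rw [← count_and_add _ (fun x : α × β => D x.1), ← count_and_not,
    ← count_prod_const (fun a => Q a ∧ D a) P c fun a h => hc a h.1 h.2,
    ← count_prod_const (fun a => Q a ∧ ¬ D a) P d fun a h => hd a h.1 h.2]
  exact congrArg₂ _ (count_congr fun x => and_right_comm) (count_congr fun x => and_right_comm)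

theorem count_not_cube_and_eq_zero :
    count (fun a : F => ¬ a ^ 3 = -1 ∧ a = 0) = 1 := by
  refine count_eq_one 0 fun a => ⟨fun h => h.2, ?_⟩
  rintro rfl
  simp

/-- Pairs consisting of a norm-one element and a solution of the associated symmetric bilinear
equation in two variables outside the cube roots of `-1`. -/
theorem count_normForm_eq_one_and_bilinear (h3 : (3 : F) ≠ 0) {q e : ℤ} (hq : Nat.card F = q)
    (he : count (fun v : F => v ^ 2 + v + 1 = 0) = e) :
    count (fun x : ((F × F × F) × F) × F =>
      ((normForm x.1.1 = 1 ∧ ¬ x.1.2 ^ 3 = -1) ∧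
        ((x.1.1.1 - 1) * x.1.2 + x.1.1.2.1) * x.2 + (x.1.1.2.1 * x.1.2 + x.1.1.2.2) = 0) ∧
      ¬ x.2 ^ 3 = -1) =
      (q - e - 1) * (q ^ 2 - 1 - (q - 1) * e) -
        (q ^ 2 - 1 - (q - 1) * e - (q - e - 1) + q - (e + 1) * (q - e)) +
        q * (q - e - 1) * (1 + e) -
        (e + 1) * ((q - e - 1) * (q - e) + (e - 1)) := by
  have hn : count (fun x : F => x ^ 3 = -1) = e + 1 := he ▸ count_cube_eq_neg_one h3
  have hm : count (fun x : F => ¬ x ^ 3 = -1) = q - e - 1 := by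
    rw [count_not, hn, hq]
    ring
  have hG := count_normForm_eq_one h3
  rw [hq, he] at hG
  have hC1 : count (fun x : (F × F × F) × F => normForm x.1 = 1 ∧ ¬ x.2 ^ 3 = -1) =
      (q ^ 2 - 1 - (q - 1) * e) * (q - e - 1) := by
    rw [count_prod_const (fun t : F × F × F => normForm t = 1) (fun _ a => ¬ a ^ 3 = -1) _
      (fun _ _ => hm), hG]
  have hC2 : count (fun x : (F × F × F) × F => (normForm x.1 = 1 ∧ ¬ x.2 ^ 3 = -1) ∧
      (x.1.1 - 1) * x.2 + x.1.2.1 = 0) =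
      q ^ 2 - 1 - (q - 1) * e - (q - e - 1) + q - (e + 1) * (q - e) := by
    rw [count_congr fun _ => and_right_comm, count_and_not,
      count_linear (fun t : F × F × F => normForm t = 1) (fun t => t.1 - 1) (fun t => t.2.1),
      hG, count_normForm_eq_one_and_fst_eq_one h3, count_normForm_eq_one_and_fst_snd, hn, hq,
      count_swap]
    have h := count_prod_const (fun a : F => a ^ 3 = -1)
      (fun a (t : F × F × F) => normForm t = 1 ∧ (t.1 - 1) * a + t.2.1 = 0) _
      (fun a ha => count_normForm_eq_one_and_root h3 ha)
    rw [hn, hq, he] at h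
    rw [count_congr fun _ => and_comm, h]
    ring
  have hC3 : count (fun x : (F × F × F) × F => (normForm x.1 = 1 ∧ ¬ x.2 ^ 3 = -1) ∧
      (x.1.1 - 1) * x.2 + x.1.2.1 = 0 ∧ x.1.2.1 * x.2 + x.1.2.2 = 0) =
      (q - e - 1) * (1 + e) := by
    have h := count_prod_const (fun a : F => ¬ a ^ 3 = -1)
      (fun a (t : F × F × F) => normForm t = 1 ∧ (t.1 - 1) * a + t.2.1 = 0 ∧
        t.2.1 * a + t.2.2 = 0) _
      (fun a ha => count_normForm_eq_one_and_both h3 ha)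
    rw [hm, he] at h
    rw [← h, count_swap]
    exact count_congr fun _ => by tauto
  have hC4 : ∀ b : F, b ^ 3 = -1 → count (fun x : (F × F × F) × F =>
      (normForm x.1 = 1 ∧ ¬ x.2 ^ 3 = -1) ∧
        ((x.1.1 - 1) * x.2 + x.1.2.1) * b + (x.1.2.1 * x.2 + x.1.2.2) = 0) =
      (q - e - 1) * (q - e) + (e - 1) := by
    intro b hb
    have h := count_prod_const_split (fun a : F => ¬ a ^ 3 = -1) (fun a => a = 0)
      (fun a (t : F × F × F) => normForm t = 1 ∧
        ((t.1 - 1) * a + t.2.1) * b + (t.2.1 * a + t.2.2) = 0) (q - 1) (q - e)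
      (fun a ha h0 => by
        rw [count_normForm_eq_one_and_bilinear_root h3 ha hb, if_pos h0, hq])
      (fun a ha h0 => by
        rw [count_normForm_eq_one_and_bilinear_root h3 ha hb, if_neg h0, hq, he])
    rw [hm, count_not_cube_and_eq_zero] at h
    rw [count_swap, count_congr fun _ => by rw [and_comm (a := normForm _ = 1), and_assoc], h]
    ring
  have hC5 := count_prod_const (fun b : F => b ^ 3 = -1) (fun b (x : (F × F × F) × F) =>
      (normForm x.1 = 1 ∧ ¬ x.2 ^ 3 = -1) ∧
        ((x.1.1 - 1) * x.2 + x.1.2.1) * b + (x.1.2.1 * x.2 + x.1.2.2) = 0) _ hC4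
  rw [count_swap, hn] at hC5
  have hC6 := count_linear (fun x : (F × F × F) × F => normForm x.1 = 1 ∧ ¬ x.2 ^ 3 = -1)
    (fun x => (x.1.1 - 1) * x.2 + x.1.2.1) (fun x => x.1.2.1 * x.2 + x.1.2.2)
  rw [hC1, hC2, hC3, hq] at hC6
  rw [count_and_not, hC6, count_congr fun _ => and_comm, hC5]
  ring

/-- Since the affine quartic is `N(c, d, -ab) + N(1 + ag) N(1 + bg)`, dividing `-(c + dg - abg²)` by
`(1 + ag)(1 + bg)` turns the points of the quartic into norm-one elements `t`. The coefficient of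
`g²` imposes on `t` a condition that is linear in each of `a` and `b`. -/
theorem count_affineQuartic_eq_count_normForm :
    count (fun x : (F × F) × (F × F) => (¬ x.1.1 ^ 3 = -1 ∧ ¬ x.1.2 ^ 3 = -1) ∧
      affineQuartic x.1.1 x.1.2 x.2.1 x.2.2 = 0) =
    count (fun x : ((F × F × F) × F) × F =>
      ((normForm x.1.1 = 1 ∧ ¬ x.1.2 ^ 3 = -1) ∧
        ((x.1.1.1 - 1) * x.1.2 + x.1.1.2.1) * x.2 + (x.1.1.2.1 * x.1.2 + x.1.1.2.2) = 0) ∧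
      ¬ x.2 ^ 3 = -1) := by
  refine count_bij
    (fun x => (((
      -(x.2.1 * (1 - x.1.1 * x.1.2 ^ 2 - x.1.1 ^ 2 * x.1.2) +
        x.2.2 * (x.1.1 ^ 2 + x.1.1 * x.1.2 + x.1.2 ^ 2) -
        x.1.1 * x.1.2 * (x.1.1 ^ 2 * x.1.2 ^ 2 - x.1.1 - x.1.2)) /
          ((1 + x.1.1 ^ 3) * (1 + x.1.2 ^ 3)),
      -(x.2.1 * (x.1.1 ^ 2 * x.1.2 ^ 2 - x.1.1 - x.1.2) +
        x.2.2 * (1 - x.1.1 * x.1.2 ^ 2 - x.1.1 ^ 2 * x.1.2) -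
        x.1.1 * x.1.2 * (x.1.1 ^ 2 + x.1.1 * x.1.2 + x.1.2 ^ 2)) /
          ((1 + x.1.1 ^ 3) * (1 + x.1.2 ^ 3)),
      -(x.2.1 * (x.1.1 ^ 2 + x.1.1 * x.1.2 + x.1.2 ^ 2) +
        x.2.2 * (x.1.1 ^ 2 * x.1.2 ^ 2 - x.1.1 - x.1.2) -
        x.1.1 * x.1.2 * (1 - x.1.1 * x.1.2 ^ 2 - x.1.1 ^ 2 * x.1.2)) /
          ((1 + x.1.1 ^ 3) * (1 + x.1.2 ^ 3))), x.1.1), x.1.2))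
    (fun x => ((x.1.2, x.2),
      (-(x.1.1.1 + x.1.1.2.1 * (x.1.2 * x.2) + x.1.1.2.2 * (x.1.2 + x.2)),
        -(x.1.1.1 * (x.1.2 + x.2) + x.1.1.2.1 + x.1.1.2.2 * (x.1.2 * x.2))))) ?_ ?_ ?_ ?_
  · rintro ⟨⟨a, b⟩, c, d⟩ ⟨⟨ha, hb⟩, h⟩
    dsimp only [affineQuartic] at ha hb h ⊢
    have ha' : 1 + a ^ 3 ≠ 0 := fun h => ha (by linear_combination h)
    have hb' : 1 + b ^ 3 ≠ 0 := fun h => hb (by linear_combination h)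
    refine ⟨⟨⟨?_, ha⟩, ?_⟩, hb⟩
    · simp only [normForm]
      field_simp
      linear_combination -(1 + a ^ 3) ^ 2 * (1 + b ^ 3) ^ 2 * h
    · field_simp
      ring
  · rintro ⟨⟨⟨r, s, w⟩, a⟩, b⟩ ⟨⟨⟨h, ha⟩, hg⟩, hb⟩
    dsimp only [affineQuartic, normForm] at ha hb h hg ⊢
    refine ⟨⟨ha, hb⟩, ?_⟩
    obtain ⟨k, hk⟩ : ∃ k, k = r * a * b + s * (a + b) + w := ⟨_, rfl⟩
    have hk' : a * b = k := by linear_combination -hk - hg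
    have key : 1 + a ^ 3 + b ^ 3 +
        (-(r + s * (a * b) + w * (a + b))) ^ 3 + (-(r * (a + b) + s + w * (a * b))) ^ 3 +
        3 * k * (-(r + s * (a * b) + w * (a + b))) * (-(r * (a + b) + s + w * (a * b))) =
        k ^ 3 - a ^ 3 * b ^ 3 := by
      rw [hk]
      linear_combination -(1 + a ^ 3) * (1 + b ^ 3) * h
    rw [← hk'] at key
    linear_combination key
  · rintro ⟨⟨a, b⟩, c, d⟩ ⟨⟨ha, hb⟩, h⟩
    dsimp only at ha hb ⊢
    have ha' : 1 + a ^ 3 ≠ 0 := fun h => ha (by linear_combination h)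
    have hb' : 1 + b ^ 3 ≠ 0 := fun h => hb (by linear_combination h)
    refine Prod.ext rfl (Prod.ext ?_ ?_) <;> dsimp only <;> field_simp <;> ring
  · rintro ⟨⟨⟨r, s, w⟩, a⟩, b⟩ ⟨⟨⟨-, ha⟩, hg⟩, hb⟩
    dsimp only at ha hb hg ⊢
    have ha' : 1 + a ^ 3 ≠ 0 := fun h => ha (by linear_combination h)
    have hb' : 1 + b ^ 3 ≠ 0 := fun h => hb (by linear_combination h)
    refine Prod.ext (Prod.ext (Prod.ext ?_ (Prod.ext ?_ ?_)) rfl) rfl <;> dsimp only <;>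
      field_simp
    · linear_combination -(a ^ 2 * b ^ 2 - a - b) * hg
    · linear_combination -(a ^ 2 + a * b + b ^ 2) * hg
    · linear_combination -(1 - a * b ^ 2 - a ^ 2 * b) * hg

theorem count_shifted_quadratic {a b : F} (hab : a ≠ b) :
    count (fun d : F => (a - b) ^ 2 + (a - b) * (b - d) + (b - d) ^ 2 = 0) =
      count (fun v : F => v ^ 2 + v + 1 = 0) := by
  rw [← count_quadratic_of_ne_zero (sub_ne_zero.mpr hab)]
  refine count_bij (fun d => b - d) (fun v => b - v) (fun _ h => h) ?_ (by simp) (by simp)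
  intro v h
  linear_combination h

/-- The points with `c = -1` of the affine quartic: there its equation is `N(a, b, d) = 0`. -/
theorem count_normForm_eq_zero (h3 : (3 : F) ≠ 0) {q e : ℤ} (hq : Nat.card F = q)
    (he : count (fun v : F => v ^ 2 + v + 1 = 0) = e) :
    count (fun x : (F × F) × F => (¬ x.1.1 ^ 3 = -1 ∧ ¬ x.1.2 ^ 3 = -1) ∧
      normForm (x.1.1, x.1.2, x.2) = 0) =
      (q - e - 1) ^ 2 + ((q - e - 1) + ((q - e - 1) ^ 2 - (q - e - 1)) * e) -
        (1 + (q - e - 2) * e) := by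
  have hn : count (fun x : F => x ^ 3 = -1) = e + 1 := he ▸ count_cube_eq_neg_one h3
  have hm : count (fun x : F => ¬ x ^ 3 = -1) = q - e - 1 := by
    rw [count_not, hn, hq]
    ring
  have hP : count (fun x : F × F => ¬ x.1 ^ 3 = -1 ∧ ¬ x.2 ^ 3 = -1) = (q - e - 1) ^ 2 := by
    rw [count_prod_const (fun a : F => ¬ a ^ 3 = -1) (fun _ b => ¬ b ^ 3 = -1) _ (fun _ _ => hm),
      hm]
    ring
  have hD : count (fun x : F × F => (¬ x.1 ^ 3 = -1 ∧ ¬ x.2 ^ 3 = -1) ∧ x.1 = x.2) =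
      q - e - 1 := by
    rw [← hm]
    refine count_bij (fun x => x.1) (fun a => (a, a)) (fun x h => h.1.1)
      (fun a h => ⟨⟨h, h⟩, rfl⟩) ?_ (by simp)
    rintro ⟨a, b⟩ ⟨-, h⟩
    exact Prod.ext rfl h
  have hS1 : count (fun x : (F × F) × F => (¬ x.1.1 ^ 3 = -1 ∧ ¬ x.1.2 ^ 3 = -1) ∧
      x.2 = -x.1.1 - x.1.2) = (q - e - 1) ^ 2 := by
    rw [count_prod_const (fun x : F × F => ¬ x.1 ^ 3 = -1 ∧ ¬ x.2 ^ 3 = -1)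
      (fun x d => d = -x.1 - x.2) 1 (fun x _ => count_eq_one _ fun _ => Iff.rfl), hP, mul_one]
  have hS2 := count_prod_const_split (fun x : F × F => ¬ x.1 ^ 3 = -1 ∧ ¬ x.2 ^ 3 = -1)
    (fun x => x.1 = x.2)
    (fun x d => (x.1 - x.2) ^ 2 + (x.1 - x.2) * (x.2 - d) + (x.2 - d) ^ 2 = 0) 1 e
    (fun x _ h => by
      refine count_eq_one x.2 fun d => ?_
      simp only [h, sub_self, zero_mul, zero_pow two_ne_zero, zero_add, sq_eq_zero_iff,
        sub_eq_zero]
      exact eq_comm)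
    (fun x _ h => by rw [count_shifted_quadratic h, he])
  rw [hP, hD] at hS2
  have hS3 : count (fun x : (F × F) × F => ((¬ x.1.1 ^ 3 = -1 ∧ ¬ x.1.2 ^ 3 = -1) ∧
      x.2 = -x.1.1 - x.1.2) ∧
      (x.1.1 - x.1.2) ^ 2 + (x.1.1 - x.1.2) * (x.1.2 - x.2) + (x.1.2 - x.2) ^ 2 = 0) =
      1 + (q - e - 2) * e := by
    have h := count_prod_const_split (fun a : F => ¬ a ^ 3 = -1) (fun a => a = 0)
      (fun a b : F => a ^ 2 + a * b + b ^ 2 = 0) 1 e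
      (fun a _ h => count_eq_one 0 fun b => by simp [h])
      (fun a _ h => by rw [count_quadratic_of_ne_zero h, he])
    rw [hm, count_not_cube_and_eq_zero] at h
    have h' : count (fun x : (F × F) × F => ((¬ x.1.1 ^ 3 = -1 ∧ ¬ x.1.2 ^ 3 = -1) ∧
        x.2 = -x.1.1 - x.1.2) ∧
        (x.1.1 - x.1.2) ^ 2 + (x.1.1 - x.1.2) * (x.1.2 - x.2) + (x.1.2 - x.2) ^ 2 = 0) =
        count (fun x : F × F => ¬ x.1 ^ 3 = -1 ∧ x.1 ^ 2 + x.1 * x.2 + x.2 ^ 2 = 0) := by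
      refine count_bij (fun x => x.1) (fun x => (x, -x.1 - x.2)) ?_ ?_ ?_ (by simp)
      · rintro ⟨⟨a, b⟩, d⟩ ⟨⟨⟨ha, -⟩, hd⟩, h⟩
        exact ⟨ha, (neg_sub_quadratic_iff h3 hd).mp h⟩
      · rintro ⟨a, b⟩ ⟨ha, h⟩
        refine ⟨⟨⟨ha, fun hb => ha ?_⟩, rfl⟩, (neg_sub_quadratic_iff h3 rfl).mpr h⟩
        dsimp only at hb h ⊢
        linear_combination (a - b) * h + hb
      · rintro ⟨⟨a, b⟩, d⟩ ⟨⟨-, h⟩, -⟩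
        exact Prod.ext rfl h.symm
    rw [h', h]
    ring
  have h := count_or (fun x : (F × F) × F => (¬ x.1.1 ^ 3 = -1 ∧ ¬ x.1.2 ^ 3 = -1) ∧
      x.2 = -x.1.1 - x.1.2)
    (fun x => (¬ x.1.1 ^ 3 = -1 ∧ ¬ x.1.2 ^ 3 = -1) ∧
      (x.1.1 - x.1.2) ^ 2 + (x.1.1 - x.1.2) * (x.1.2 - x.2) + (x.1.2 - x.2) ^ 2 = 0)
  rw [hS1, hS2] at h
  rw [count_congr fun _ => by rw [normForm_eq_zero_iff, and_or_left], h,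
    count_congr (Q := fun x : (F × F) × F => ((¬ x.1.1 ^ 3 = -1 ∧ ¬ x.1.2 ^ 3 = -1) ∧
      x.2 = -x.1.1 - x.1.2) ∧
      (x.1.1 - x.1.2) ^ 2 + (x.1.1 - x.1.2) * (x.1.2 - x.2) + (x.1.2 - x.2) ^ 2 = 0)
      fun _ => by tauto, hS3]
  ring

/-- Rescaling `d` by `-c` reduces the case of a general cube root `c` of `-1` to `c = -1`. -/
theorem count_affineQuartic_of_cube (h3 : (3 : F) ≠ 0) {q e : ℤ} (hq : Nat.card F = q)
    (he : count (fun v : F => v ^ 2 + v + 1 = 0) = e) {c : F} (hc : c ^ 3 = -1) :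
    count (fun x : (F × F) × F => (¬ x.1.1 ^ 3 = -1 ∧ ¬ x.1.2 ^ 3 = -1) ∧
      affineQuartic x.1.1 x.1.2 c x.2 = 0) =
      (q - e - 1) ^ 2 + ((q - e - 1) + ((q - e - 1) ^ 2 - (q - e - 1)) * e) -
        (1 + (q - e - 2) * e) := by
  rw [← count_normForm_eq_zero h3 hq he]
  refine count_bij (fun x => (x.1, -c * x.2)) (fun x => (x.1, c ^ 2 * x.2)) ?_ ?_ ?_ ?_
  · rintro ⟨⟨a, b⟩, d⟩ ⟨h, h'⟩
    refine ⟨h, ?_⟩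
    simp only [affineQuartic, normForm] at h' ⊢
    linear_combination h' - (1 + d ^ 3) * hc
  · rintro ⟨⟨a, b⟩, d⟩ ⟨h, h'⟩
    refine ⟨h, ?_⟩
    simp only [affineQuartic, normForm] at h' ⊢
    linear_combination h' + (1 + d ^ 3 * (c ^ 3 - 1) + 3 * a * b * d) * hc
  · rintro ⟨x, d⟩ -
    refine Prod.ext rfl ?_
    dsimp only
    linear_combination -d * hc
  · rintro ⟨x, d⟩ -
    refine Prod.ext rfl ?_
    dsimp only
    linear_combination -d * hc

/-- For each admissible `a` there are `e + 1` values of `b`. Those that are cube roots of `-1`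
have to be discarded; for each such `b` the equation in `a` is `(1 - xa)² (2 + xa) = 0` with
`x = bcd`, and only the simple root is admissible. -/
theorem count_affineQuartic_of_cube_of_cube (h3 : (3 : F) ≠ 0) {q e : ℤ} (hq : Nat.card F = q)
    (he : count (fun v : F => v ^ 2 + v + 1 = 0) = e) {c d : F} (hc : c ^ 3 = -1)
    (hd : d ^ 3 = -1) :
    count (fun x : F × F => (¬ x.1 ^ 3 = -1 ∧ ¬ x.2 ^ 3 = -1) ∧
      affineQuartic x.1 x.2 c d = 0) = (e + 1) * (q - e - 2) := by
  have hn : count (fun x : F => x ^ 3 = -1) = e + 1 := he ▸ count_cube_eq_neg_one h3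
  have hm : count (fun x : F => ¬ x ^ 3 = -1) = q - e - 1 := by
    rw [count_not, hn, hq]
    ring
  have hA : ∀ a b, affineQuartic a b c d = normForm (c * d * a, -1, b) := by
    intro a b
    simp only [affineQuartic, normForm]
    linear_combination (1 - a ^ 3 * d ^ 3) * hc + (1 + a ^ 3) * hd
  have hb : ∀ a : F, ¬ a ^ 3 = -1 → count (fun b => affineQuartic a b c d = 0) = e + 1 := by
    intro a ha
    have ha' : ¬ (c * d * a) ^ 3 = -1 := by
      intro h
      apply ha
      linear_combination h - a ^ 3 * d ^ 3 * hc + a ^ 3 * hd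
    have hne : c * d * a ≠ -1 := ne_neg_one_of_cube ha'
    simp only [hA, normForm_eq_zero_iff]
    have h0 : count (fun b : F => b = -(c * d * a) - -1 ∧
        (c * d * a - -1) ^ 2 + (c * d * a - -1) * (-1 - b) + (-1 - b) ^ 2 = 0) = 0 := by
      refine count_eq_zero ?_
      rintro b ⟨hb, h⟩
      rw [neg_sub_quadratic_iff h3 hb] at h
      apply ha'
      linear_combination (c * d * a + 1) * h
    rw [count_or, count_eq_one _ fun _ => Iff.rfl, count_shifted_quadratic hne, he, h0]
    ring
  have ha : ∀ b : F, b ^ 3 = -1 →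
      count (fun a : F => ¬ a ^ 3 = -1 ∧ affineQuartic a b c d = 0) = 1 := by
    intro b hb
    refine count_eq_one (2 * (b * c * d) ^ 2) fun a => ?_
    have hθ : (b * c * d) ^ 3 = -1 := by
      linear_combination c ^ 3 * d ^ 3 * hb - d ^ 3 * hc + hd
    generalize hx : b * c * d = x at hθ
    have hA' : affineQuartic a b c d = (1 - x * a) ^ 2 * (-2 - x * a) := by
      rw [← hx] at hθ ⊢
      simp only [affineQuartic]
      linear_combination hb + hc + hd + a ^ 3 * hθ
    rw [hA']
    constructor
    · rintro ⟨ha, h⟩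
      rcases mul_eq_zero.mp h with h | h
      · have h1 : 1 - x * a = 0 := by simpa using h
        refine absurd ?_ ha
        linear_combination (1 + x * a + x ^ 2 * a ^ 2) * h1 + a ^ 3 * hθ
      · linear_combination x ^ 2 * h + a * hθ
    · rintro rfl
      refine ⟨fun h => two_cube_ne_neg_one h3 ?_, ?_⟩
      · linear_combination h - 8 * (x ^ 3 - 1) * hθ
      · linear_combination (-2) * (1 - x * (2 * x ^ 2)) ^ 2 * hθ
  have hB := count_prod_const (fun a : F => ¬ a ^ 3 = -1)
    (fun a b => affineQuartic a b c d = 0) _ hb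
  have hR := count_prod_const (fun b : F => b ^ 3 = -1)
    (fun b a => ¬ a ^ 3 = -1 ∧ affineQuartic a b c d = 0) _ ha
  rw [count_swap, hn] at hR
  rw [hm] at hB
  rw [count_congr fun _ => and_right_comm, count_and_not, hB, count_congr fun _ => and_comm, hR]
  ring

/-- The points of the affine quartic none of whose coordinates is a cube root of `-1`. -/
theorem count_affineQuartic (h3 : (3 : F) ≠ 0) {q e : ℤ} (hq : Nat.card F = q)
    (he : count (fun v : F => v ^ 2 + v + 1 = 0) = e) :
    count (fun x : (F × F) × (F × F) => ((¬ x.1.1 ^ 3 = -1 ∧ ¬ x.1.2 ^ 3 = -1) ∧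
      affineQuartic x.1.1 x.1.2 x.2.1 x.2.2 = 0) ∧ ¬ (x.2.1 ^ 3 = -1 ∨ x.2.2 ^ 3 = -1)) =
      (q - e - 1) * (q ^ 2 - 1 - (q - 1) * e) -
        (q ^ 2 - 1 - (q - 1) * e - (q - e - 1) + q - (e + 1) * (q - e)) +
        q * (q - e - 1) * (1 + e) -
        (e + 1) * ((q - e - 1) * (q - e) + (e - 1)) -
      2 * (e + 1) * ((q - e - 1) ^ 2 + ((q - e - 1) + ((q - e - 1) ^ 2 - (q - e - 1)) * e) -
        (1 + (q - e - 2) * e)) + (e + 1) ^ 2 * ((e + 1) * (q - e - 2)) := by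
  have hn : count (fun x : F => x ^ 3 = -1) = e + 1 := he ▸ count_cube_eq_neg_one h3
  have hM := count_normForm_eq_one_and_bilinear h3 hq he
  rw [← count_affineQuartic_eq_count_normForm] at hM
  have hK := count_prod_const (fun c : F => c ^ 3 = -1)
    (fun c (x : (F × F) × F) => (¬ x.1.1 ^ 3 = -1 ∧ ¬ x.1.2 ^ 3 = -1) ∧
      affineQuartic x.1.1 x.1.2 c x.2 = 0) _
    (fun c hc => count_affineQuartic_of_cube h3 hq he hc)
  rw [hn] at hK
  generalize (q - e - 1) ^ 2 + ((q - e - 1) + ((q - e - 1) ^ 2 - (q - e - 1)) * e) -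
    (1 + (q - e - 2) * e) = K at hK ⊢
  have hc : count (fun x : (F × F) × (F × F) => ((¬ x.1.1 ^ 3 = -1 ∧ ¬ x.1.2 ^ 3 = -1) ∧
      affineQuartic x.1.1 x.1.2 x.2.1 x.2.2 = 0) ∧ x.2.1 ^ 3 = -1) = (e + 1) * K := by
    rw [← hK]
    exact count_bij (fun x => (x.2.1, x.1, x.2.2)) (fun x => (x.2.1, x.1, x.2.2))
      (fun _ h => h.symm) (fun _ h => h.symm) (fun _ _ => rfl) (fun _ _ => rfl)
  have hd : count (fun x : (F × F) × (F × F) => ((¬ x.1.1 ^ 3 = -1 ∧ ¬ x.1.2 ^ 3 = -1) ∧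
      affineQuartic x.1.1 x.1.2 x.2.1 x.2.2 = 0) ∧ x.2.2 ^ 3 = -1) = (e + 1) * K := by
    rw [← hc]
    have hs : ∀ a b c d : F, affineQuartic a b c d = affineQuartic a b d c := by
      intro a b c d
      simp only [affineQuartic]
      ring
    refine count_bij (fun x => (x.1, x.2.2, x.2.1)) (fun x => (x.1, x.2.2, x.2.1))
      ?_ ?_ (fun _ _ => rfl) (fun _ _ => rfl)
    · rintro x ⟨⟨h, h'⟩, h''⟩
      exact ⟨⟨h, (hs _ _ _ _).trans h'⟩, h''⟩
    · rintro x ⟨⟨h, h'⟩, h''⟩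
      exact ⟨⟨h, (hs _ _ _ _).trans h'⟩, h''⟩
  have hR : count (fun x : F × F => x.1 ^ 3 = -1 ∧ x.2 ^ 3 = -1) = (e + 1) ^ 2 := by
    rw [count_prod_const (fun a : F => a ^ 3 = -1) (fun _ b => b ^ 3 = -1) _ (fun _ _ => hn), hn]
    ring
  have hcd := count_prod_const (fun y : F × F => y.1 ^ 3 = -1 ∧ y.2 ^ 3 = -1)
    (fun y (x : F × F) => (¬ x.1 ^ 3 = -1 ∧ ¬ x.2 ^ 3 = -1) ∧
      affineQuartic x.1 x.2 y.1 y.2 = 0) _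
    (fun y hy => count_affineQuartic_of_cube_of_cube h3 hq he hy.1 hy.2)
  rw [count_swap, hR] at hcd
  have hor := count_or
    (fun x : (F × F) × (F × F) => ((¬ x.1.1 ^ 3 = -1 ∧ ¬ x.1.2 ^ 3 = -1) ∧
      affineQuartic x.1.1 x.1.2 x.2.1 x.2.2 = 0) ∧ x.2.1 ^ 3 = -1)
    (fun x => ((¬ x.1.1 ^ 3 = -1 ∧ ¬ x.1.2 ^ 3 = -1) ∧
      affineQuartic x.1.1 x.1.2 x.2.1 x.2.2 = 0) ∧ x.2.2 ^ 3 = -1)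
  rw [hc, hd, count_congr fun _ => and_and_left.symm, count_congr fun _ => and_comm,
    hcd] at hor
  rw [count_and_not, hM, count_congr fun _ => and_or_left, hor]
  ring

end Chart

/-! ### Reduction to the affine chart -/

section Projective

variable {F : Type*} [Field F]

theorem aeval_quartic (v : Fin 5 → F) :
    aeval v quartic = v 0 * (v 0 ^ 3 + v 1 ^ 3 + v 2 ^ 3 + v 3 ^ 3 + v 4 ^ 3) +
      3 * (v 1 * v 2 * v 3 * v 4) := by
  simp [quartic]

theorem aeval_quartic_chart (a b c d : F) :
    aeval ![1, a, b, c, d] quartic = affineQuartic a b c d := by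
  rw [aeval_quartic]
  simp [affineQuartic]
  ring

/-- On the chart `y₀ = 1` of the quartic, the Hessian is `-9` times the product of the
`1 + yᵢ³`. -/
theorem aeval_hessian_chart {a b c d : F} (h : affineQuartic a b c d = 0) :
    aeval ![1, a, b, c, d] hessian =
      -3 ^ 2 * ((1 + a ^ 3) * (1 + b ^ 3) * (1 + c ^ 3) * (1 + d ^ 3)) := by
  rw [hessian_eq]
  simp [hessianExpanded]
  simp only [affineQuartic] at h
  -- In terms of the elementary symmetric functions `sᵢ` of the cubes and of `p = abcd`, the
  -- multiplier of the equation `1 + s₁ + 3p = 0` is `9 + 6p + 6p² + s₂ - p (1 + s₁ + 3p)`.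
  linear_combination (9 + 6 * (a * b * c * d) + 6 * (a * b * c * d) ^ 2 +
    (a ^ 3 * b ^ 3 + a ^ 3 * c ^ 3 + a ^ 3 * d ^ 3 + b ^ 3 * c ^ 3 + b ^ 3 * d ^ 3 +
      c ^ 3 * d ^ 3) -
    (a * b * c * d) * (1 + a ^ 3 + b ^ 3 + c ^ 3 + d ^ 3 + 3 * a * b * c * d)) * h

/-- Where `y₀` vanishes, the quartic form reduces to `3 y₁ y₂ y₃ y₄`, which divides the Hessian. -/
theorem aeval_hessian_of_zero (h3 : (3 : F) ≠ 0) {v : Fin 5 → F} (h0 : v 0 = 0)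
    (h : aeval v quartic = 0) : aeval v hessian = 0 := by
  have hp : v 1 * v 2 * v 3 * v 4 = 0 := by
    rw [aeval_quartic, h0, zero_mul, zero_add, mul_eq_zero, or_iff_right h3] at h
    exact h
  rw [hessian_eq]
  simp [hessianExpanded, h0, hp]

variable [Fintype F]

/-- All points of the quartic off its Hessian lie in the chart `y₀ = 1`, where they are the
points none of whose coordinates is a cube root of `-1`. -/
theorem natCard_diff_eq_count (h3 : (3 : F) ≠ 0) :
    (Nat.card ↥(B F \ He F) : ℤ) =
      count (fun x : (F × F) × (F × F) => ((¬ x.1.1 ^ 3 = -1 ∧ ¬ x.1.2 ^ 3 = -1) ∧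
        affineQuartic x.1.1 x.1.2 x.2.1 x.2.2 = 0) ∧
          ¬ (x.2.1 ^ 3 = -1 ∨ x.2.2 ^ 3 = -1)) := by
  have hne : ∀ a b c d : F, ![1, a, b, c, d] ≠ 0 := fun a b c d h =>
    one_ne_zero (congrFun h 0)
  have hmem : ∀ a b c d : F, Projectivization.mk F _ (hne a b c d) ∈ B F \ He F ↔
      ((¬ a ^ 3 = -1 ∧ ¬ b ^ 3 = -1) ∧ affineQuartic a b c d = 0) ∧
        ¬ (c ^ 3 = -1 ∨ d ^ 3 = -1) := by
    intro a b c d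
    rw [Set.mem_sdiff, mk_mem_B, mk_mem_He, aeval_quartic_chart]
    have h1 : ∀ x : F, 1 + x ^ 3 = 0 ↔ x ^ 3 = -1 := fun x => by
      rw [add_comm, add_eq_zero_iff_eq_neg]
    constructor
    · rintro ⟨h, h'⟩
      rw [aeval_hessian_chart h] at h'
      simp only [mul_eq_zero, neg_eq_zero, pow_eq_zero_iff two_ne_zero, h3, h1] at h'
      tauto
    · rintro ⟨⟨hab, h⟩, hcd⟩
      refine ⟨h, ?_⟩
      rw [aeval_hessian_chart h]
      simp only [mul_eq_zero, neg_eq_zero, pow_eq_zero_iff two_ne_zero, h3, h1]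
      tauto
  rw [count_eq_natCard]
  refine congrArg _ (Nat.card_congr (Equiv.ofBijective
    (fun x => ⟨Projectivization.mk F _ (hne x.1.1.1 x.1.1.2 x.1.2.1 x.1.2.2),
      (hmem _ _ _ _).mpr x.2⟩) ⟨?_, ?_⟩).symm)
  · rintro ⟨⟨⟨a, b⟩, c, d⟩, hx⟩ ⟨⟨⟨a', b'⟩, c', d'⟩, hx'⟩ h
    obtain ⟨k, hk⟩ := (Projectivization.mk_eq_mk_iff' F _ _ _ _).mp (Subtype.mk.inj h)
    have e0 := congrFun hk 0
    have e1 := congrFun hk 1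
    have e2 := congrFun hk 2
    have e3 := congrFun hk 3
    have e4 := congrFun hk 4
    simp at e0 e1 e2 e3 e4
    subst e0
    simp_all
  · rintro ⟨P, hP⟩
    induction P using Projectivization.ind with
    | h v hv =>
    have h0 : v 0 ≠ 0 := fun h0 => hP.2 ((mk_mem_He v hv).mpr
      (aeval_hessian_of_zero h3 h0 ((mk_mem_B v hv).mp hP.1)))
    have e : Projectivization.mk F _ (hne (v 1 / v 0) (v 2 / v 0) (v 3 / v 0) (v 4 / v 0)) =
        Projectivization.mk F v hv := by
      rw [Projectivization.mk_eq_mk_iff']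
      refine ⟨(v 0)⁻¹, ?_⟩
      ext i
      fin_cases i <;> simp [h0, div_eq_inv_mul]
    exact ⟨⟨((v 1 / v 0, v 2 / v 0), (v 3 / v 0, v 4 / v 0)),
      (hmem _ _ _ _).mp (e ▸ hP)⟩, Subtype.ext e⟩

end Projective

/-! ### Cube roots of unity -/

section RootsOfUnity

variable {F : Type*} [Field F]

theorem three_ne_zero_of_not_dvd (h : ¬ 3 ∣ Nat.card F) : (3 : F) ≠ 0 := by
  intro h3
  apply h
  have : Fact (Nat.Prime 3) := ⟨Nat.prime_three⟩
  rw [← addOrderOf_eq_prime (p := 3) (x := (1 : F)) (by simpa using h3) one_ne_zero]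
  exact addOrderOf_dvd_natCard 1

variable [Fintype F]

theorem count_primitive_cube_roots_eq_two (h3 : (3 : F) ≠ 0) (h : Nat.card F ≡ 1 [MOD 3]) :
    count (fun v : F => v ^ 2 + v + 1 = 0) = 2 := by
  classical
  have : Fact (Nat.Prime 3) := ⟨Nat.prime_three⟩
  have hd : 3 ∣ Nat.card Fˣ := by
    rw [Nat.card_units]
    exact (Nat.modEq_iff_dvd' Nat.card_pos).mp h.symm
  obtain ⟨z, hz⟩ := exists_prime_orderOf_dvd_card' 3 hd
  have hz3 : (z : F) ^ 3 = 1 := by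
    rw [← Units.val_pow_eq_pow_val, ← hz, pow_orderOf_eq_one, Units.val_one]
  have hz1 : (z : F) ≠ 1 := by
    intro h1
    rw [Units.val_eq_one] at h1
    simp [h1] at hz
  have hq : (z : F) ^ 2 + z + 1 = 0 :=
    (mul_eq_zero.mp (by linear_combination hz3 :
      ((z : F) - 1) * ((z : F) ^ 2 + z + 1) = 0)).resolve_left (sub_ne_zero.mpr hz1)
  have h1 : count (fun v : F => v ^ 2 + v + 1 = 0) =
      count (fun v : F => v = z ∨ v = -1 - z) := by
    refine count_congr fun v => ?_
    rw [← sub_eq_zero (b := (z : F)), ← sub_eq_zero (b := -1 - (z : F)), ← mul_eq_zero]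
    constructor
    · intro h
      linear_combination h - hq
    · intro h
      linear_combination h + hq
  have h0 : count (fun v : F => v = z ∧ v = -1 - z) = 0 := by
    refine count_eq_zero ?_
    rintro v ⟨rfl, h⟩
    apply h3
    linear_combination 4 * hq - (2 * (z : F) + 1) * h
  rw [h1, count_or, h0, count_eq_one _ fun _ => Iff.rfl, count_eq_one _ fun _ => Iff.rfl]
  norm_num

theorem count_primitive_cube_roots_eq_zero (h3 : (3 : F) ≠ 0) (h : Nat.card F ≡ 2 [MOD 3]) :
    count (fun v : F => v ^ 2 + v + 1 = 0) = 0 := by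
  refine count_eq_zero fun v hv => ?_
  have hv3 : v ^ 3 = 1 := by linear_combination (v - 1) * hv
  have hv1 : v ≠ 1 := by
    rintro rfl
    apply h3
    linear_combination hv
  have hv0 : v ≠ 0 := by
    rintro rfl
    simp at hv
  have : Fact (Nat.Prime 3) := ⟨Nat.prime_three⟩
  have ho : orderOf (Units.mk0 v hv0) = 3 := by
    refine orderOf_eq_prime (Units.ext ?_) fun h => hv1 ?_
    · simpa using hv3
    · simpa using congrArg Units.val h
  have hd : 3 ∣ Nat.card Fˣ := ho ▸ orderOf_dvd_natCard _
  rw [Nat.card_units] at hd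
  have := Nat.card_pos (α := F)
  have h' : Nat.card F % 3 = 2 := h
  omega

end RootsOfUnity

end Burkhardt

theorem corollary2p4 (F : Type*) [Field F] [Finite F] (q : ℕ) (hq : Nat.card F = q) :
    (q ≡ 1 [MOD 3] →
      (Nat.card ↥(Burkhardt.B F \ Burkhardt.He F) : ℤ) =
        ((q : ℤ) - 4) * ((q : ℤ) - 7) * ((q : ℤ) - 13)) ∧
    (q ≡ 2 [MOD 3] →
      (Nat.card ↥(Burkhardt.B F \ Burkhardt.He F) : ℤ) =
        ((q : ℤ) - 2) * ((q : ℤ) ^ 2 - 2 * (q : ℤ) - 1)) := by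
  have := Fintype.ofFinite F
  subst hq
  constructor
  · intro h
    have h3 : (3 : F) ≠ 0 := Burkhardt.three_ne_zero_of_not_dvd fun hd => by
      have h' : Nat.card F % 3 = 1 := h
      omega
    rw [Burkhardt.natCard_diff_eq_count h3, Burkhardt.count_affineQuartic h3 rfl
      (Burkhardt.count_primitive_cube_roots_eq_two h3 h)]
    ring
  · intro h
    have h3 : (3 : F) ≠ 0 := Burkhardt.three_ne_zero_of_not_dvd fun hd => by
      have h' : Nat.card F % 3 = 2 := h
      omega
    rw [Burkhardt.natCard_diff_eq_count h3, Burkhardt.count_affineQuartic h3 rfl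
      (Burkhardt.count_primitive_cube_roots_eq_zero h3 h)]
    ring
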